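/- Let $v,d\in\mathbb{C}$ with $d\neq 0$ and $v\neq 0$, and let $V(v,d)\subset\mathbb{C}P^2$ be the plane curve with equation $$P = X u_0^2-2v(u_2^2+u_1^2)u_2u_0+Xu_2^2=0,\qquad X=du_2^2+2vu_1u_2+du_1^2,$$ in homogeneous coordinates $[u_0,u_1,u_2]$. A point of $V(v,d)$ is singular if all first partial derivatives of $P$ vanish there. A singular point is a node (ordinary double point) if it has multiplicity two with two distinct tangent lines. It is an ordinary cusp if it has multiplicity two with a single tangent line, and this line meets the curve at the point with intersection multiplicity exactly three. Then the following hold. 1. $V(v,d)$ is an irreducible quartic curve: $P$ is an irreducible homogeneous polynomial of degree $4$, and $V(v,d)$ is a nonempty projective variety that is not the union of two proper subvarieties. 2. If $d\neq\pm 2v$, the singular points of $V(v,d)$ are exactly $[1,0,0]$ and $[0,1,0]$. 3. If $d=2v$, there is exactly one more singular point, $[1,-1,1]$, in addition to the singular points $[1,0,0]$ and $[0,1,0]$, and it is a node. 4. If $d=-2v$, there is exactly one more singular point, $[-1,1,1]$, in addition to the singular points $[1,0,0]$ and $[0,1,0]$, and it is a node. 5. If $d^2\neq v^2$ (in particular if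 $d=\pm 2v$), then $[1,0,0]$ and $[0,1,0]$ are both nodes of $V(v,d)$. If $d^2=v^2$, both are ordinary cusps. -/

import Mathlib

open MvPolynomial
open scoped LinearAlgebra.Projectivization

noncomputable section

namespace PlaneCurve

/-- The complex projective plane, with homogeneous coordinates `[u₀, u₁, u₂]`. -/
abbrev CP2 : Type := ℙ ℂ (Fin 3 → ℂ)

/-- The zero set in the projective plane of a homogeneous polynomial `F`. -/
def zeroSet (F : MvPolynomial (Fin 3) ℂ) : Set CP2 :=
  {p | eval p.rep F = 0}

/-- For a homogeneous polynomial the vanishing at a point may be tested on any representative. -/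
theorem eval_rep_eq_zero_iff {F : MvPolynomial (Fin 3) ℂ} {n : ℕ} (hF : F.IsHomogeneous n)
    {w : Fin 3 → ℂ} (hw : w ≠ 0) :
    eval (Projectivization.mk ℂ w hw).rep F = 0 ↔ eval w F = 0 := by
  obtain ⟨a, ha⟩ := Projectivization.exists_smul_eq_mk_rep ℂ w hw
  have h : eval (fun i => (a : ℂ) * w i) F = (a : ℂ) ^ n * eval w F := by
    rw [eval_eq, eval_eq, Finset.mul_sum]
    refine Finset.sum_congr rfl fun m hm => ?_
    have hdeg : ∑ i ∈ m.support, m i = n := by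
      have := hF (mem_support_iff.mp hm)
      simpa [Finsupp.weight_apply, Finsupp.sum] using this
    simp only [mul_pow, Finset.prod_mul_distrib, Finset.prod_pow_eq_pow_sum, hdeg]
    ring
  have h2 : (Projectivization.mk ℂ w hw).rep = fun i => (a : ℂ) * w i := by
    rw [← ha]; rfl
  rw [h2, h]
  simp

/-- A projective algebraic subset of the plane: the common zero set of a set of homogeneous
polynomials. -/
def IsAlgebraicSet (Z : Set CP2) : Prop :=
  ∃ S : Set (MvPolynomial (Fin 3) ℂ),
    (∀ F ∈ S, ∃ n : ℕ, F.IsHomogeneous n) ∧ Z = {p | ∀ F ∈ S, p ∈ zeroSet F}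

/-- An irreducible projective variety: a nonempty algebraic set that is not the union of two
proper algebraic subsets. -/
def IsIrreducibleVariety (Z : Set CP2) : Prop :=
  IsAlgebraicSet Z ∧ Z.Nonempty ∧
    ∀ A B : Set CP2, IsAlgebraicSet A → IsAlgebraicSet B → Z = A ∪ B → Z = A ∨ Z = B

/-- The singular points of the plane curve `F = 0`: the points of the curve at which all first
partial derivatives of the homogeneous polynomial `F` vanish. -/
def singularPoints (F : MvPolynomial (Fin 3) ℂ) : Set CP2 :=
  {p | p ∈ zeroSet F ∧ ∀ i : Fin 3, eval p.rep (pderiv i F) = 0}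

/-- The equation of the curve `F = 0` in the affine chart `u_i = 1`, in affine coordinates
centred at the point `[w]` (where `w i = 1`): the coordinate `u_i` is set to `w i`, and the two
other coordinates are `u_k = w k + X₀`, `u_l = w l + X₁` with `k < l`. -/
def localEquation (F : MvPolynomial (Fin 3) ℂ) (w : Fin 3 → ℂ) (i : Fin 3) :
    MvPolynomial (Fin 2) ℂ :=
  aeval (fun k : Fin 3 =>
    C (w k) + (i.insertNth (0 : MvPolynomial (Fin 2) ℂ) X : Fin 3 → MvPolynomial (Fin 2) ℂ) k) F

/-- The affine plane curve `f = 0` has a node (ordinary double point) at the origin: the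
multiplicity is two and there are two distinct tangent lines `L = 0` and `M = 0`. -/
def IsNodeAtOrigin (f : MvPolynomial (Fin 2) ℂ) : Prop :=
  homogeneousComponent 0 f = 0 ∧ homogeneousComponent 1 f = 0 ∧
    ∃ L M : MvPolynomial (Fin 2) ℂ, L.IsHomogeneous 1 ∧ M.IsHomogeneous 1 ∧
      LinearIndependent ℂ ![L, M] ∧ homogeneousComponent 2 f = L * M

/-- The affine plane curve `f = 0` has an ordinary cusp at the origin: the multiplicity is two,
there is only one tangent line `L = 0` (so that the quadratic part of `f` is `L ^ 2` for a suitable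
scaling of `L`), and this line meets the curve at the origin with intersection multiplicity exactly
three, that is, `L` does not divide the cubic part of `f`. -/
def IsOrdinaryCuspAtOrigin (f : MvPolynomial (Fin 2) ℂ) : Prop :=
  homogeneousComponent 0 f = 0 ∧ homogeneousComponent 1 f = 0 ∧
    ∃ L : MvPolynomial (Fin 2) ℂ, L.IsHomogeneous 1 ∧ L ≠ 0 ∧
      homogeneousComponent 2 f = L ^ 2 ∧ ¬ L ∣ homogeneousComponent 3 f

/-- The curve `F = 0` has a node at `p` (in every standard affine chart that contains `p`). -/
def IsNode (F : MvPolynomial (Fin 3) ℂ) (p : CP2) : Prop :=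
  ∀ (w : Fin 3 → ℂ) (hw : w ≠ 0) (i : Fin 3), Projectivization.mk ℂ w hw = p → w i = 1 →
    IsNodeAtOrigin (localEquation F w i)

/-- The curve `F = 0` has an ordinary cusp at `p` (in every standard affine chart that
contains `p`). -/
def IsOrdinaryCusp (F : MvPolynomial (Fin 3) ℂ) (p : CP2) : Prop :=
  ∀ (w : Fin 3 → ℂ) (hw : w ≠ 0) (i : Fin 3), Projectivization.mk ℂ w hw = p → w i = 1 →
    IsOrdinaryCuspAtOrigin (localEquation F w i)

end PlaneCurve

namespace EqualVelocity

open PlaneCurve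

/-- The binary form `X = d u₂² + 2 v u₁ u₂ + d u₁²`. -/
def formX (v d : ℂ) : MvPolynomial (Fin 3) ℂ :=
  C d * X 2 ^ 2 + C (2 * v) * X 1 * X 2 + C d * X 1 ^ 2

/-- The quartic form `P = X u₀² - 2 v (u₂² + u₁²) u₂ u₀ + X u₂²`. -/
def quartic (v d : ℂ) : MvPolynomial (Fin 3) ℂ :=
  formX v d * X 0 ^ 2 - C (2 * v) * (X 2 ^ 2 + X 1 ^ 2) * X 2 * X 0 + formX v d * X 2 ^ 2

/-- The plane curve `V(v,d)`, the zero set of the quartic form `P`. -/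
def V (v d : ℂ) : Set CP2 := zeroSet (quartic v d)

/-- The point `[1,0,0]`. -/
def point100 : CP2 := Projectivization.mk ℂ ![1, 0, 0] (by simp)

/-- The point `[0,1,0]`. -/
def point010 : CP2 := Projectivization.mk ℂ ![0, 1, 0] (by simp)

/-- The point `[1,-1,1]`. -/
def pointPlus : CP2 := Projectivization.mk ℂ ![1, -1, 1] (by simp)

/-- The point `[-1,1,1]`. -/
def pointMinus : CP2 := Projectivization.mk ℂ ![-1, 1, 1] (by simp)

end EqualVelocity

end

/-! Irreducibility: over `ℂ[u₁, u₂]` the quartic is quadratic in `u₀`, with coefficients `X`,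
`-2v(u₁² + u₂²)u₂` and `X u₂²`. The first two have no common factor, and the discriminant
`4u₂²(v²(u₁² + u₂²)² - X²)` is not a square, since already at `u₂ = 1` comparing coefficients forces
`v = 0`; so `irreducible_of_disc_ne_sq` applies. The Nullstellensatz carries irreducibility over to
the variety (`isIrreducibleVariety_zeroSet`).

Singular points: on `u₂ = 0` the equation reads `d u₁² u₀² = 0`, which leaves `[1,0,0]` and
`[0,1,0]`. On `u₂ = 1`, elimination forces `u₀² = u₁² = 1`, and the choice of signs determines `d`
(`singular_affine`).

Types: at each singular point the local equation is quadratic + cubic + quartic. The discriminant of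
the quadratic part separates nodes from cusps; for a cusp, the cubic part is evaluated on the double
tangent. -/

open MvPolynomial
open scoped LinearAlgebra.Projectivization

/-! ### Node and cusp criteria from the Taylor expansion -/

namespace PlaneCurve

/-- The general binary cubic form. -/
noncomputable def binaryCubic (a b c e : ℂ) : MvPolynomial (Fin 2) ℂ :=
  C a * X 0 ^ 3 + C b * X 0 ^ 2 * X 1 + C c * X 0 * X 1 ^ 2 + C e * X 1 ^ 3

/-- The general binary quartic form. -/
noncomputable def binaryQuartic (a b c e f : ℂ) : MvPolynomial (Fin 2) ℂ :=
  C a * X 0 ^ 4 + C b * X 0 ^ 3 * X 1 + C c * X 0 ^ 2 * X 1 ^ 2 + C e * X 0 * X 1 ^ 3 +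
    C f * X 1 ^ 4

theorem isHomogeneous_C_mul_X_pow_mul_X_pow {σ R : Type*} [CommSemiring R] (a : R) (i j : σ)
    (m n : ℕ) : (C a * X i ^ m * X j ^ n : MvPolynomial σ R).IsHomogeneous (m + n) :=
  (isHomogeneous_C_mul_X_pow a i m).mul (isHomogeneous_X_pow j n)

theorem isHomogeneous_binaryLinear (a b : ℂ) :
    (C a * X 0 + C b * X 1 : MvPolynomial (Fin 2) ℂ).IsHomogeneous 1 :=
  (isHomogeneous_C_mul_X a 0).add (isHomogeneous_C_mul_X b 1)

theorem isHomogeneous_binaryCubic (a b c e : ℂ) : (binaryCubic a b c e).IsHomogeneous 3 := by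
  have h := fun (a : ℂ) m n ↦ isHomogeneous_C_mul_X_pow_mul_X_pow a (0 : Fin 2) 1 m n
  convert (((h a 3 0).add (h b 2 1)).add (h c 1 2)).add (h e 0 3) using 1
  simp [binaryCubic]

theorem isHomogeneous_binaryQuartic (a b c e f : ℂ) :
    (binaryQuartic a b c e f).IsHomogeneous 4 := by
  have h := fun (a : ℂ) m n ↦ isHomogeneous_C_mul_X_pow_mul_X_pow a (0 : Fin 2) 1 m n
  convert ((((h a 4 0).add (h b 3 1)).add (h c 2 2)).add (h e 1 3)).add (h f 0 4) using 1
  simp [binaryQuartic]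

theorem homogeneousComponents_of_quadratic_add_cubic_add_quartic {σ R : Type*} [CommSemiring R]
    {f Q A B : MvPolynomial σ R} (hf : f = Q + A + B) (hQ : Q.IsHomogeneous 2)
    (hA : A.IsHomogeneous 3) (hB : B.IsHomogeneous 4) :
    homogeneousComponent 0 f = 0 ∧ homogeneousComponent 1 f = 0 ∧
      homogeneousComponent 2 f = Q ∧ homogeneousComponent 3 f = A := by
  have h (n : ℕ) : homogeneousComponent n f =
      (if 2 = n then Q else 0) + (if 3 = n then A else 0) + (if 4 = n then B else 0) := by
    rw [hf, map_add, map_add, homogeneousComponent_of_mem hQ, homogeneousComponent_of_mem hA,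
      homogeneousComponent_of_mem hB]
    simp only [eq_comm]
  refine ⟨?_, ?_, ?_, ?_⟩ <;> rw [h] <;> simp

theorem linearIndependent_binaryLinear {a b c e : ℂ} (h : a * e - b * c ≠ 0) :
    LinearIndependent ℂ ![(C a * X 0 + C b * X 1 : MvPolynomial (Fin 2) ℂ),
      C c * X 0 + C e * X 1] := by
  rw [LinearIndependent.pair_iff]
  intro s t hst
  have h0 : s * a + t * c = 0 := by
    simpa [smul_eval] using congrArg (eval ![1, 0]) hst
  have h1 : s * b + t * e = 0 := by
    simpa [smul_eval] using congrArg (eval ![0, 1]) hst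
  constructor
  · have : s * (a * e - b * c) = 0 := by linear_combination e * h0 - c * h1
    exact (mul_eq_zero.mp this).resolve_right h
  · have : t * (a * e - b * c) = 0 := by linear_combination a * h1 - b * h0
    exact (mul_eq_zero.mp this).resolve_right h

/-- A curve with quadratic part `α X₀² + 2 β X₀ X₁ + γ X₁²` of nonzero discriminant has a node. -/
theorem isNodeAtOrigin_of_disc_ne_zero {f A B : MvPolynomial (Fin 2) ℂ} {α β γ : ℂ}
    (hA : A.IsHomogeneous 3) (hB : B.IsHomogeneous 4)
    (hf : f = C α * X 0 ^ 2 + C (2 * β) * X 0 * X 1 + C γ * X 1 ^ 2 + A + B)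
    (hα : α ≠ 0) (hdisc : β ^ 2 ≠ α * γ) : IsNodeAtOrigin f := by
  -- A square root of the discriminant splits the quadratic part into the two tangent lines.
  obtain ⟨s, hs⟩ := IsAlgClosed.exists_pow_nat_eq (β ^ 2 - α * γ) (n := 2) (by norm_num)
  have hs0 : s ≠ 0 := by
    rintro rfl
    exact hdisc (by linear_combination -hs)
  have hQ : (C α * X 0 ^ 2 + C (2 * β) * X 0 * X 1 + C γ * X 1 ^ 2 : MvPolynomial (Fin 2) ℂ) =
      (C 1 * X 0 + C (α⁻¹ * (β + s)) * X 1) * (C α * X 0 + C (β - s) * X 1) := by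
    have h1 : (C (2 * β) : MvPolynomial (Fin 2) ℂ) =
        C (1 * (β - s) + α⁻¹ * (β + s) * α) := by
      congr 1; field_simp; ring
    have h2 : (C γ : MvPolynomial (Fin 2) ℂ) = C (α⁻¹ * (β + s) * (β - s)) := by
      congr 1; field_simp; linear_combination hs
    rw [h1, h2]
    simp only [C_add, C_mul, C_1]
    ring
  have hQ2 : (C α * X 0 ^ 2 + C (2 * β) * X 0 * X 1 + C γ * X 1 ^ 2 :
      MvPolynomial (Fin 2) ℂ).IsHomogeneous 2 := by
    rw [hQ]
    exact (isHomogeneous_binaryLinear _ _).mul (isHomogeneous_binaryLinear _ _)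
  obtain ⟨hc0, hc1, hc2, -⟩ :=
    homogeneousComponents_of_quadratic_add_cubic_add_quartic hf hQ2 hA hB
  refine ⟨hc0, hc1, _, _, isHomogeneous_binaryLinear _ _,
    isHomogeneous_binaryLinear _ _, linearIndependent_binaryLinear ?_, hc2.trans hQ⟩
  -- The determinant of the two linear forms is `(β - s) - (β + s) = -2s`.
  field_simp
  intro h
  exact hs0 (by linear_combination (-1 / 2) * h)

/-- A curve with quadratic part `α (X₀ + e X₁)²` and a cubic part that does not vanish on the
line `X₀ + e X₁ = 0` has an ordinary cusp. -/
theorem isOrdinaryCuspAtOrigin_of_sq {f A B : MvPolynomial (Fin 2) ℂ} {α e : ℂ}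
    (hA : A.IsHomogeneous 3) (hB : B.IsHomogeneous 4)
    (hf : f = C α * (X 0 + C e * X 1) ^ 2 + A + B)
    (hα : α ≠ 0) (hcubic : eval ![-e, 1] A ≠ 0) : IsOrdinaryCuspAtOrigin f := by
  obtain ⟨s, hs⟩ := IsAlgClosed.exists_pow_nat_eq α (n := 2) (by norm_num)
  have hs0 : s ≠ 0 := by
    rintro rfl
    exact hα (by simpa using hs.symm)
  have hQ : (C α * (X 0 + C e * X 1) ^ 2 : MvPolynomial (Fin 2) ℂ) =
      (C s * X 0 + C (s * e) * X 1) ^ 2 := by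
    simp only [← hs, C_mul, C_pow]
    ring
  have hQ2 : (C α * (X 0 + C e * X 1) ^ 2 : MvPolynomial (Fin 2) ℂ).IsHomogeneous 2 := by
    rw [hQ]
    exact (isHomogeneous_binaryLinear _ _).pow 2
  obtain ⟨hc0, hc1, hc2, hc3⟩ :=
    homogeneousComponents_of_quadratic_add_cubic_add_quartic hf hQ2 hA hB
  refine ⟨hc0, hc1, _, isHomogeneous_binaryLinear s (s * e), ?_,
    hc2.trans hQ, ?_⟩
  · intro h
    exact hs0 (by simpa using congrArg (eval ![1, 0]) h)
  · rw [hc3]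
    rintro ⟨M, hM⟩
    -- The tangent form vanishes at `(-e, 1)`, hence so would any multiple of it.
    have := congrArg (eval ![-e, 1]) hM
    simp at this
    exact hcubic this

theorem eq_smul_of_mk_eq_mk {w u : Fin 3 → ℂ} {hw : w ≠ 0} {hu : u ≠ 0}
    (h : Projectivization.mk ℂ w hw = Projectivization.mk ℂ u hu) :
    ∃ a : ℂ, ∀ i, w i = a * u i := by
  obtain ⟨a, rfl⟩ := (Projectivization.mk_eq_mk_iff' ℂ w u hw hu).mp h
  exact ⟨a, fun i ↦ rfl⟩

/-- Membership in the singular locus may be tested on any representative. -/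
theorem mk_mem_singularPoints_iff {F : MvPolynomial (Fin 3) ℂ} {n : ℕ} (hF : F.IsHomogeneous n)
    {w : Fin 3 → ℂ} (hw : w ≠ 0) :
    Projectivization.mk ℂ w hw ∈ singularPoints F ↔
      eval w F = 0 ∧ ∀ i, eval w (pderiv i F) = 0 := by
  simp only [singularPoints, zeroSet, Set.mem_ofPred_eq, eval_rep_eq_zero_iff hF hw,
    eval_rep_eq_zero_iff hF.pderiv hw]

end PlaneCurve

/-! ### Local equations and types of the singular points -/

namespace EqualVelocity

open PlaneCurve

/-- `IsNode` and `IsOrdinaryCusp` range over all charts and normalised representatives; here only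
one pair is possible. -/
theorem eq_of_mk_eq_point100 {w : Fin 3 → ℂ} {hw : w ≠ 0} {i : Fin 3}
    (h : Projectivization.mk ℂ w hw = point100) (hi : w i = 1) : i = 0 ∧ w = ![1, 0, 0] := by
  obtain ⟨a, ha⟩ := eq_smul_of_mk_eq_mk h
  have hai := ha i
  rw [hi] at hai
  fin_cases i <;> simp at hai
  refine ⟨rfl, ?_⟩
  ext j
  rw [ha, ← hai]
  simp

theorem eq_of_mk_eq_point010 {w : Fin 3 → ℂ} {hw : w ≠ 0} {i : Fin 3}
    (h : Projectivization.mk ℂ w hw = point010) (hi : w i = 1) : i = 1 ∧ w = ![0, 1, 0] := by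
  obtain ⟨a, ha⟩ := eq_smul_of_mk_eq_mk h
  have hai := ha i
  rw [hi] at hai
  fin_cases i <;> simp at hai
  refine ⟨rfl, ?_⟩
  ext j
  rw [ha, ← hai]
  simp

/-- No coordinate of the point vanishes, so it lies in all three charts, and each fixes the scaling.
-/
theorem eq_of_mk_eq_pointPlus {w : Fin 3 → ℂ} {hw : w ≠ 0} {i : Fin 3}
    (h : Projectivization.mk ℂ w hw = pointPlus) (hi : w i = 1) :
    i = 0 ∧ w = ![1, -1, 1] ∨ i = 1 ∧ w = ![-1, 1, -1] ∨ i = 2 ∧ w = ![1, -1, 1] := by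
  obtain ⟨a, ha⟩ := eq_smul_of_mk_eq_mk h
  have hai := ha i
  rw [hi] at hai
  have hw' : w = ![a, -a, a] := by
    ext j
    rw [ha]
    fin_cases j <;> simp
  fin_cases i <;> simp at hai
  · simp [hw', ← hai]
  · simp [hw', neg_eq_iff_eq_neg.mp hai.symm]
  · simp [hw', ← hai]

theorem eq_of_mk_eq_pointMinus {w : Fin 3 → ℂ} {hw : w ≠ 0} {i : Fin 3}
    (h : Projectivization.mk ℂ w hw = pointMinus) (hi : w i = 1) :
    i = 0 ∧ w = ![1, -1, -1] ∨ i = 1 ∧ w = ![-1, 1, 1] ∨ i = 2 ∧ w = ![-1, 1, 1] := by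
  obtain ⟨a, ha⟩ := eq_smul_of_mk_eq_mk h
  have hai := ha i
  rw [hi] at hai
  have hw' : w = ![-a, a, a] := by
    ext j
    rw [ha]
    fin_cases j <;> simp
  fin_cases i <;> simp at hai
  · simp [hw', neg_eq_iff_eq_neg.mp hai.symm]
  · simp [hw', ← hai]
  · simp [hw', ← hai]

/-- Here and below the middle quadratic coefficient is written `2 * β`, the shape that
`isNodeAtOrigin_of_disc_ne_zero` expects. At this point and at `[0,1,0]`, `β² - αγ = v² - d²`. -/
theorem localEquation_quartic_point100 (v d : ℂ) :
    localEquation (quartic v d) ![1, 0, 0] 0 =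
      C d * X 0 ^ 2 + C (2 * v) * X 0 * X 1 + C d * X 1 ^ 2 +
        binaryCubic 0 (-(2 * v)) 0 (-(2 * v)) + binaryQuartic 0 0 d (2 * v) d := by
  simp [localEquation, quartic, formX, binaryCubic, binaryQuartic, algebraMap_eq,
    Fin.insertNth, Fin.succAboveCases]
  ring

theorem localEquation_quartic_point010 (v d : ℂ) :
    localEquation (quartic v d) ![0, 1, 0] 1 =
      C d * X 0 ^ 2 + C (2 * (-v)) * X 0 * X 1 + C d * X 1 ^ 2 +
        binaryCubic 0 (2 * v) 0 (2 * v) + binaryQuartic 0 0 d (-(2 * v)) d := by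
  simp [localEquation, quartic, formX, binaryCubic, binaryQuartic, algebraMap_eq,
    Fin.insertNth, Fin.succAboveCases]
  ring

/-- In every chart, at this point and at `[-1,1,1]`, `β² - αγ = -4v²`. -/
theorem localEquation_quartic_pointPlus_0 (v : ℂ) :
    localEquation (quartic v (2 * v)) ![1, -1, 1] 0 =
      C (2 * v) * X 0 ^ 2 + C (2 * (2 * v)) * X 0 * X 1 + C (4 * v) * X 1 ^ 2 +
        binaryCubic 0 (2 * v) (2 * v) (4 * v) +
        binaryQuartic 0 0 (2 * v) (2 * v) (2 * v) := by
  simp [localEquation, quartic, formX, binaryCubic, binaryQuartic, algebraMap_eq,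
    Fin.insertNth, Fin.succAboveCases]
  simp only [map_ofNat]
  ring

theorem localEquation_quartic_pointPlus_1 (v : ℂ) :
    localEquation (quartic v (2 * v)) ![-1, 1, -1] 1 =
      C (2 * v) * X 0 ^ 2 + C (2 * (-(2 * v))) * X 0 * X 1 + C (4 * v) * X 1 ^ 2 +
        binaryCubic 0 (-(2 * v)) (2 * v) (-(4 * v)) +
        binaryQuartic 0 0 (2 * v) (-(2 * v)) (2 * v) := by
  simp [localEquation, quartic, formX, binaryCubic, binaryQuartic, algebraMap_eq,
    Fin.insertNth, Fin.succAboveCases]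
  simp only [map_ofNat]
  ring

theorem localEquation_quartic_pointPlus_2 (v : ℂ) :
    localEquation (quartic v (2 * v)) ![1, -1, 1] 2 =
      C (2 * v) * X 0 ^ 2 + C (2 * (0)) * X 0 * X 1 + C (2 * v) * X 1 ^ 2 +
        binaryCubic 0 (-(2 * v)) (2 * v) 0 +
        binaryQuartic 0 0 (2 * v) 0 0 := by
  simp [localEquation, quartic, formX, binaryCubic, binaryQuartic, algebraMap_eq,
    Fin.insertNth, Fin.succAboveCases]
  simp only [map_ofNat]
  ring

theorem localEquation_quartic_pointMinus_0 (v : ℂ) :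
    localEquation (quartic v (-(2 * v))) ![1, -1, -1] 0 =
      C (-(2 * v)) * X 0 ^ 2 + C (2 * (2 * v)) * X 0 * X 1 + C (-(4 * v)) * X 1 ^ 2 +
        binaryCubic 0 (2 * v) (-(2 * v)) (4 * v) +
        binaryQuartic 0 0 (-(2 * v)) (2 * v) (-(2 * v)) := by
  simp [localEquation, quartic, formX, binaryCubic, binaryQuartic, algebraMap_eq,
    Fin.insertNth, Fin.succAboveCases]
  simp only [map_ofNat]
  ring

theorem localEquation_quartic_pointMinus_1 (v : ℂ) :
    localEquation (quartic v (-(2 * v))) ![-1, 1, 1] 1 =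
      C (-(2 * v)) * X 0 ^ 2 + C (2 * (-(2 * v))) * X 0 * X 1 + C (-(4 * v)) * X 1 ^ 2 +
        binaryCubic 0 (-(2 * v)) (-(2 * v)) (-(4 * v)) +
        binaryQuartic 0 0 (-(2 * v)) (-(2 * v)) (-(2 * v)) := by
  simp [localEquation, quartic, formX, binaryCubic, binaryQuartic, algebraMap_eq,
    Fin.insertNth, Fin.succAboveCases]
  simp only [map_ofNat]
  ring

theorem localEquation_quartic_pointMinus_2 (v : ℂ) :
    localEquation (quartic v (-(2 * v))) ![-1, 1, 1] 2 =
      C (-(2 * v)) * X 0 ^ 2 + C (2 * (0)) * X 0 * X 1 + C (-(2 * v)) * X 1 ^ 2 +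
        binaryCubic 0 (-(2 * v)) (2 * v) 0 +
        binaryQuartic 0 0 (-(2 * v)) 0 0 := by
  simp [localEquation, quartic, formX, binaryCubic, binaryQuartic, algebraMap_eq,
    Fin.insertNth, Fin.succAboveCases]
  simp only [map_ofNat]
  ring

theorem isNode_quartic_point100 {v d : ℂ} (hd : d ≠ 0) (h : d ^ 2 ≠ v ^ 2) :
    IsNode (quartic v d) point100 := by
  rintro w hw i hp hi
  obtain ⟨rfl, rfl⟩ := eq_of_mk_eq_point100 hp hi
  refine isNodeAtOrigin_of_disc_ne_zero (isHomogeneous_binaryCubic _ _ _ _)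
    (isHomogeneous_binaryQuartic _ _ _ _ _) (localEquation_quartic_point100 v d) hd fun h' ↦ h ?_
  linear_combination -h'

theorem isNode_quartic_point010 {v d : ℂ} (hd : d ≠ 0) (h : d ^ 2 ≠ v ^ 2) :
    IsNode (quartic v d) point010 := by
  rintro w hw i hp hi
  obtain ⟨rfl, rfl⟩ := eq_of_mk_eq_point010 hp hi
  refine isNodeAtOrigin_of_disc_ne_zero (isHomogeneous_binaryCubic _ _ _ _)
    (isHomogeneous_binaryQuartic _ _ _ _ _) (localEquation_quartic_point010 v d) hd fun h' ↦ h ?_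
  linear_combination -h'

/-- The sign `e` lets the cusp proofs treat `v = d` and `v = -d` together. -/
theorem exists_eq_mul_of_sq_eq_sq {v d : ℂ} (h : d ^ 2 = v ^ 2) :
    ∃ e : ℂ, e ^ 2 = 1 ∧ v = d * e := by
  rcases sq_eq_sq_iff_eq_or_eq_neg.mp h with rfl | rfl
  · exact ⟨1, by simp⟩
  · exact ⟨-1, by simp⟩

theorem isOrdinaryCusp_quartic_point100 {v d : ℂ} (hd : d ≠ 0) (h : d ^ 2 = v ^ 2) :
    IsOrdinaryCusp (quartic v d) point100 := by
  rintro w hw i hp hi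
  obtain ⟨rfl, rfl⟩ := eq_of_mk_eq_point100 hp hi
  obtain ⟨e, he, rfl⟩ := exists_eq_mul_of_sq_eq_sq h
  have he' : (C e : MvPolynomial (Fin 2) ℂ) ^ 2 = 1 := by rw [← C_pow, he, C_1]
  have he0 : e ≠ 0 := by rintro rfl; simp at he
  have hf : localEquation (quartic (d * e) d) ![1, 0, 0] 0 =
      C d * (X 0 + C e * X 1) ^ 2 + binaryCubic 0 (-(2 * (d * e))) 0 (-(2 * (d * e))) +
        binaryQuartic 0 0 d (2 * (d * e)) d := by
    rw [localEquation_quartic_point100]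
    simp only [C_mul, map_ofNat]
    linear_combination (-C d * X 1 ^ 2) * he'
  refine isOrdinaryCuspAtOrigin_of_sq (isHomogeneous_binaryCubic _ _ _ _)
    (isHomogeneous_binaryQuartic _ _ _ _ _) hf hd ?_
  -- Value of the cubic part at `(-e, 1)`, simplified by `e² = 1`.
  suffices -(4 * d * e) ≠ 0 by
    convert this using 1
    simp [binaryCubic]
    linear_combination (-2 * d * e) * he
  simp [hd, he0]

theorem isOrdinaryCusp_quartic_point010 {v d : ℂ} (hd : d ≠ 0) (h : d ^ 2 = v ^ 2) :
    IsOrdinaryCusp (quartic v d) point010 := by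
  rintro w hw i hp hi
  obtain ⟨rfl, rfl⟩ := eq_of_mk_eq_point010 hp hi
  obtain ⟨e, he, rfl⟩ := exists_eq_mul_of_sq_eq_sq h
  have he' : (C (-e) : MvPolynomial (Fin 2) ℂ) ^ 2 = 1 := by rw [← C_pow, neg_sq, he, C_1]
  have he0 : e ≠ 0 := by rintro rfl; simp at he
  have hf : localEquation (quartic (d * e) d) ![0, 1, 0] 1 =
      C d * (X 0 + C (-e) * X 1) ^ 2 + binaryCubic 0 (2 * (d * e)) 0 (2 * (d * e)) +
        binaryQuartic 0 0 d (-(2 * (d * e))) d := by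
    rw [localEquation_quartic_point010]
    simp only [← mul_neg, C_mul, map_ofNat]
    linear_combination (-C d * X 1 ^ 2) * he'
  refine isOrdinaryCuspAtOrigin_of_sq (isHomogeneous_binaryCubic _ _ _ _)
    (isHomogeneous_binaryQuartic _ _ _ _ _) hf hd ?_
  suffices 4 * d * e ≠ 0 by
    convert this using 1
    simp [binaryCubic]
    linear_combination (2 * d * e) * he
  simp [hd, he0]

theorem isNode_quartic_pointPlus {v : ℂ} (hv : v ≠ 0) : IsNode (quartic v (2 * v)) pointPlus := by
  have hv2 : v ^ 2 ≠ 0 := pow_ne_zero 2 hv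
  rintro w hw i hp hi
  obtain ⟨rfl, rfl⟩ | ⟨rfl, rfl⟩ | ⟨rfl, rfl⟩ := eq_of_mk_eq_pointPlus hp hi
  · refine isNodeAtOrigin_of_disc_ne_zero (isHomogeneous_binaryCubic _ _ _ _)
      (isHomogeneous_binaryQuartic _ _ _ _ _) (localEquation_quartic_pointPlus_0 v) (by simp [hv])
      fun h ↦ hv2 ?_
    linear_combination (-1 / 4) * h
  · refine isNodeAtOrigin_of_disc_ne_zero (isHomogeneous_binaryCubic _ _ _ _)
      (isHomogeneous_binaryQuartic _ _ _ _ _) (localEquation_quartic_pointPlus_1 v) (by simp [hv])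
      fun h ↦ hv2 ?_
    linear_combination (-1 / 4) * h
  · refine isNodeAtOrigin_of_disc_ne_zero (isHomogeneous_binaryCubic _ _ _ _)
      (isHomogeneous_binaryQuartic _ _ _ _ _) (localEquation_quartic_pointPlus_2 v) (by simp [hv])
      fun h ↦ hv2 ?_
    linear_combination (-1 / 4) * h

theorem isNode_quartic_pointMinus {v : ℂ} (hv : v ≠ 0) :
    IsNode (quartic v (-(2 * v))) pointMinus := by
  have hv2 : v ^ 2 ≠ 0 := pow_ne_zero 2 hv
  rintro w hw i hp hi
  obtain ⟨rfl, rfl⟩ | ⟨rfl, rfl⟩ | ⟨rfl, rfl⟩ := eq_of_mk_eq_pointMinus hp hi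
  · refine isNodeAtOrigin_of_disc_ne_zero (isHomogeneous_binaryCubic _ _ _ _)
      (isHomogeneous_binaryQuartic _ _ _ _ _) (localEquation_quartic_pointMinus_0 v) (by simp [hv])
      fun h ↦ hv2 ?_
    linear_combination (-1 / 4) * h
  · refine isNodeAtOrigin_of_disc_ne_zero (isHomogeneous_binaryCubic _ _ _ _)
      (isHomogeneous_binaryQuartic _ _ _ _ _) (localEquation_quartic_pointMinus_1 v) (by simp [hv])
      fun h ↦ hv2 ?_
    linear_combination (-1 / 4) * h
  · refine isNodeAtOrigin_of_disc_ne_zero (isHomogeneous_binaryCubic _ _ _ _)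
      (isHomogeneous_binaryQuartic _ _ _ _ _) (localEquation_quartic_pointMinus_2 v) (by simp [hv])
      fun h ↦ hv2 ?_
    linear_combination (-1 / 4) * h

end EqualVelocity

/-! ### Determination of the singular locus -/

namespace EqualVelocity

open PlaneCurve

theorem eval_quartic (v d : ℂ) (w : Fin 3 → ℂ) :
    eval w (quartic v d) =
      (d * w 2 ^ 2 + 2 * v * w 1 * w 2 + d * w 1 ^ 2) * (w 0 ^ 2 + w 2 ^ 2) -
        2 * v * (w 2 ^ 2 + w 1 ^ 2) * w 2 * w 0 := by
  simp [quartic, formX]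
  ring

theorem eval_pderiv_zero_quartic (v d : ℂ) (w : Fin 3 → ℂ) :
    eval w (pderiv 0 (quartic v d)) =
      2 * (d * w 2 ^ 2 + 2 * v * w 1 * w 2 + d * w 1 ^ 2) * w 0 -
        2 * v * (w 2 ^ 2 + w 1 ^ 2) * w 2 := by
  simp [quartic, formX, pderiv_X]
  ring

theorem eval_pderiv_one_quartic (v d : ℂ) (w : Fin 3 → ℂ) :
    eval w (pderiv 1 (quartic v d)) =
      (2 * v * w 2 + 2 * d * w 1) * (w 0 ^ 2 + w 2 ^ 2) - 4 * v * w 1 * w 2 * w 0 := by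
  simp [quartic, formX, pderiv_X]
  ring

theorem eval_pderiv_two_quartic (v d : ℂ) (w : Fin 3 → ℂ) :
    eval w (pderiv 2 (quartic v d)) =
      (2 * d * w 2 + 2 * v * w 1) * (w 0 ^ 2 + w 2 ^ 2) +
        2 * (d * w 2 ^ 2 + 2 * v * w 1 * w 2 + d * w 1 ^ 2) * w 2 -
        2 * v * (3 * w 2 ^ 2 + w 1 ^ 2) * w 0 := by
  simp [quartic, formX, pderiv_X]
  ring

theorem isHomogeneous_quartic (v d : ℂ) : (quartic v d).IsHomogeneous 4 := by
  have hX : (formX v d).IsHomogeneous 2 :=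
    ((isHomogeneous_C_mul_X_pow d 2 2).add
      ((isHomogeneous_C_mul_X (2 * v) 1).mul (isHomogeneous_X _ 2))).add
      (isHomogeneous_C_mul_X_pow d 1 2)
  exact ((hX.mul (isHomogeneous_X_pow 0 2)).sub
    (((((isHomogeneous_X_pow 2 2).add (isHomogeneous_X_pow 1 2)).C_mul (2 * v)).mul
      (isHomogeneous_X _ 2)).mul (isHomogeneous_X _ 0))).add (hX.mul (isHomogeneous_X_pow 2 2))

theorem mk_mem_singularPoints_quartic_iff {v d : ℂ} {w : Fin 3 → ℂ} (hw : w ≠ 0) :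
    Projectivization.mk ℂ w hw ∈ singularPoints (quartic v d) ↔
      eval w (quartic v d) = 0 ∧ eval w (pderiv 0 (quartic v d)) = 0 ∧
        eval w (pderiv 1 (quartic v d)) = 0 ∧ eval w (pderiv 2 (quartic v d)) = 0 := by
  rw [mk_mem_singularPoints_iff (isHomogeneous_quartic v d), Fin.forall_fin_succ, Fin.forall_fin_two]
  rfl

theorem point100_mem_singularPoints (v d : ℂ) : point100 ∈ singularPoints (quartic v d) := by
  simp [point100, mk_mem_singularPoints_quartic_iff, eval_quartic, eval_pderiv_zero_quartic,
    eval_pderiv_one_quartic, eval_pderiv_two_quartic]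

theorem point010_mem_singularPoints (v d : ℂ) : point010 ∈ singularPoints (quartic v d) := by
  simp [point010, mk_mem_singularPoints_quartic_iff, eval_quartic, eval_pderiv_zero_quartic,
    eval_pderiv_one_quartic, eval_pderiv_two_quartic]

theorem pointPlus_mem_singularPoints (v : ℂ) :
    pointPlus ∈ singularPoints (quartic v (2 * v)) := by
  rw [pointPlus, mk_mem_singularPoints_quartic_iff, eval_quartic, eval_pderiv_zero_quartic,
    eval_pderiv_one_quartic, eval_pderiv_two_quartic]
  refine ⟨?_, ?_, ?_, ?_⟩ <;> simp <;> ring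

theorem pointMinus_mem_singularPoints (v : ℂ) :
    pointMinus ∈ singularPoints (quartic v (-(2 * v))) := by
  rw [pointMinus, mk_mem_singularPoints_quartic_iff, eval_quartic, eval_pderiv_zero_quartic,
    eval_pderiv_one_quartic, eval_pderiv_two_quartic]
  refine ⟨?_, ?_, ?_, ?_⟩ <;> simp <;> ring

theorem pointPlus_ne_point100 : pointPlus ≠ point100 := fun h ↦ by
  obtain ⟨a, ha⟩ := eq_smul_of_mk_eq_mk h
  simpa using ha 2

theorem pointPlus_ne_point010 : pointPlus ≠ point010 := fun h ↦ by
  obtain ⟨a, ha⟩ := eq_smul_of_mk_eq_mk h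
  simpa using ha 2

theorem pointMinus_ne_point100 : pointMinus ≠ point100 := fun h ↦ by
  obtain ⟨a, ha⟩ := eq_smul_of_mk_eq_mk h
  simpa using ha 2

theorem pointMinus_ne_point010 : pointMinus ≠ point010 := fun h ↦ by
  obtain ⟨a, ha⟩ := eq_smul_of_mk_eq_mk h
  simpa using ha 2

/-- The singular points on the line `u₂ = 1`. -/
theorem singular_affine {v d x y : ℂ} (hd : d ≠ 0) (hv : v ≠ 0)
    (h : (d + 2 * v * y + d * y ^ 2) * (x ^ 2 + 1) - 2 * v * (1 + y ^ 2) * x = 0)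
    (h0 : 2 * (d + 2 * v * y + d * y ^ 2) * x - 2 * v * (1 + y ^ 2) = 0)
    (h1 : (2 * v + 2 * d * y) * (x ^ 2 + 1) - 4 * v * y * x = 0) :
    d = 2 * v ∧ x = 1 ∧ y = -1 ∨ d = -(2 * v) ∧ x = -1 ∧ y = 1 := by
  -- `P - x ∂P/∂x` cancels the term with `1 + y²`.
  have hX : (d + 2 * v * y + d * y ^ 2) * (1 - x ^ 2) = 0 := by linear_combination h - x * h0
  have hx : x ^ 2 = 1 := by
    rcases mul_eq_zero.mp hX with hX | hx
    -- If `X = 0`, then `h0` gives `1 + y² = 0`, so `X = d(1 + y²) + 2vy` reduces to `2vy`, and `y =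
    -- 0` contradicts `1 + y² = 0`.
    · exfalso
      have hy2 : 1 + y ^ 2 = 0 := by
        have : v * (1 + y ^ 2) = 0 := by linear_combination x * hX - h0 / 2
        exact (mul_eq_zero.mp this).resolve_left hv
      have hy : y = 0 := by
        have : v * y = 0 := by linear_combination hX / 2 - d / 2 * hy2
        exact (mul_eq_zero.mp this).resolve_left hv
      simp [hy] at hy2
    · linear_combination -hx
  -- Once `x² = 1`, the condition `h1` is linear in `y`.
  have hL : (d - v * x) * y = -v := by linear_combination h1 / 4 - (v + d * y) / 2 * hx
  have hne : d - v * x ≠ 0 := fun h' ↦ hv (by linear_combination hL - y * h')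
  have hy : y ^ 2 = 1 := by
    have : (d - v * x) * (1 - y ^ 2) = 0 := by
      linear_combination x * h0 / 2 - (d + 2 * v * y + d * y ^ 2) * hx - 2 * y * hL
    linear_combination -(mul_eq_zero.mp this).resolve_left hne
  rcases sq_eq_sq_iff_eq_or_eq_neg.mp (hx.trans (one_pow 2).symm) with rfl | rfl
  all_goals rcases sq_eq_sq_iff_eq_or_eq_neg.mp (hy.trans (one_pow 2).symm) with rfl | rfl
  · exact absurd (by linear_combination hL) hd
  · exact .inl ⟨by linear_combination -hL, rfl, rfl⟩
  · exact .inr ⟨by linear_combination hL, rfl, rfl⟩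
  · exact absurd (by linear_combination -hL) hd

theorem singularPoints_quartic_cases {v d : ℂ} (hd : d ≠ 0) (hv : v ≠ 0) {p : CP2}
    (hp : p ∈ singularPoints (quartic v d)) :
    p = point100 ∨ p = point010 ∨ d = 2 * v ∧ p = pointPlus ∨ d = -(2 * v) ∧ p = pointMinus := by
  induction p using Projectivization.ind with
  | h w hw =>
  -- `∂P/∂u₂` can be dropped: on `u₂ = 0` the equation of the curve suffices, and elsewhere Euler's
  -- relation recovers it from the rest.
  obtain ⟨h, h0, h1, -⟩ := (mk_mem_singularPoints_quartic_iff hw).mp hp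
  rw [eval_quartic] at h
  rw [eval_pderiv_zero_quartic] at h0
  rw [eval_pderiv_one_quartic] at h1
  by_cases hz : w 2 = 0
  · have hxy : w 1 = 0 ∨ w 0 = 0 := by simpa [hz, hd] using h
    rcases hxy with hy | hx
    · left
      refine (Projectivization.mk_eq_mk_iff' ℂ _ _ _ _).mpr ⟨w 0, ?_⟩
      ext i
      fin_cases i <;> simp [hy, hz]
    · right; left
      refine (Projectivization.mk_eq_mk_iff' ℂ _ _ _ _).mpr ⟨w 1, ?_⟩
      ext i
      fin_cases i <;> simp [hx, hz]
  · right; right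
    obtain ⟨x, hx⟩ : ∃ x, w 0 = w 2 * x := ⟨w 0 / w 2, by field_simp⟩
    obtain ⟨y, hy⟩ : ∃ y, w 1 = w 2 * y := ⟨w 1 / w 2, by field_simp⟩
    rw [hx, hy] at h h0 h1
    refine (singular_affine (x := x) (y := y) hd hv ?_ ?_ ?_).imp ?_ ?_
    · exact (mul_eq_zero.mp (by linear_combination h : w 2 ^ 4 * _ = 0)).resolve_left
        (pow_ne_zero 4 hz)
    · exact (mul_eq_zero.mp (by linear_combination h0 : w 2 ^ 3 * _ = 0)).resolve_left
        (pow_ne_zero 3 hz)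
    · exact (mul_eq_zero.mp (by linear_combination h1 : w 2 ^ 3 * _ = 0)).resolve_left
        (pow_ne_zero 3 hz)
    · rintro ⟨hdv, rfl, rfl⟩
      refine ⟨hdv, (Projectivization.mk_eq_mk_iff' ℂ _ _ _ _).mpr ⟨w 2, ?_⟩⟩
      ext i
      fin_cases i <;> simp [hx, hy]
    · rintro ⟨hdv, rfl, rfl⟩
      refine ⟨hdv, (Projectivization.mk_eq_mk_iff' ℂ _ _ _ _).mpr ⟨w 2, ?_⟩⟩
      ext i
      fin_cases i <;> simp [hx, hy]

theorem singularPoints_quartic {v d : ℂ} (hd : d ≠ 0) (hv : v ≠ 0) (h : d ≠ 2 * v)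
    (h' : d ≠ -(2 * v)) : singularPoints (quartic v d) = {point100, point010} := by
  ext p
  refine ⟨fun hp ↦ ?_, ?_⟩
  · simpa [h, h'] using singularPoints_quartic_cases hd hv hp
  · rintro (rfl | rfl)
    exacts [point100_mem_singularPoints v d, point010_mem_singularPoints v d]

theorem singularPoints_quartic_two_mul {v : ℂ} (hv : v ≠ 0) :
    singularPoints (quartic v (2 * v)) = {point100, point010, pointPlus} := by
  have h : 2 * v ≠ -(2 * v) := fun h ↦ hv (by linear_combination h / 4)
  ext p
  refine ⟨fun hp ↦ ?_, ?_⟩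
  · simpa [h] using singularPoints_quartic_cases (by simpa using hv) hv hp
  · rintro (rfl | rfl | rfl)
    exacts [point100_mem_singularPoints _ _, point010_mem_singularPoints _ _,
      pointPlus_mem_singularPoints v]

theorem singularPoints_quartic_neg_two_mul {v : ℂ} (hv : v ≠ 0) :
    singularPoints (quartic v (-(2 * v))) = {point100, point010, pointMinus} := by
  have h : -(2 * v) ≠ 2 * v := fun h ↦ hv (by linear_combination -h / 4)
  ext p
  refine ⟨fun hp ↦ ?_, ?_⟩
  · simpa [h] using singularPoints_quartic_cases (by simpa using hv) hv hp
  · rintro (rfl | rfl | rfl)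
    exacts [point100_mem_singularPoints _ _, point010_mem_singularPoints _ _,
      pointMinus_mem_singularPoints v]

end EqualVelocity

/-! ### Irreducibility criteria -/

namespace PlaneCurve

/-- The zero set of an irreducible form is an irreducible variety as soon as it is nonempty. -/
theorem isIrreducibleVariety_zeroSet {F : MvPolynomial (Fin 3) ℂ} {n : ℕ}
    (hF : F.IsHomogeneous n) (hirr : Irreducible F) (hne : (zeroSet F).Nonempty) :
    IsIrreducibleVariety (zeroSet F) := by
  -- The affine cone contains the origin, which is no projective point. A form with a projective
  -- zero vanishes there too; nonzero constants are the forms to exclude.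
  have eval_zero_of_mem {G : MvPolynomial (Fin 3) ℂ} {m : ℕ} (hG : G.IsHomogeneous m) {p : CP2}
      (hp : p ∈ zeroSet G) : eval 0 G = 0 := by
    rcases eq_or_ne m 0 with rfl | hm
    · rw [totalDegree_eq_zero_iff_eq_C.mp (Nat.le_zero.mp hG.totalDegree_le)] at hp ⊢
      simpa [zeroSet] using hp
    · rw [show eval 0 G = coeff 0 G by rw [← constantCoeff_eq, ← eval_zero]]
      exact hG.coeff_eq_zero (by simpa using hm.symm)
  refine ⟨⟨{F}, by simpa using ⟨n, hF⟩, by simp⟩, hne, ?_⟩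
  rintro _ _ ⟨S, hS, rfl⟩ ⟨T, hT, rfl⟩ hST
  set A : Set CP2 := {p | ∀ G ∈ S, p ∈ zeroSet G}
  set B : Set CP2 := {p | ∀ G ∈ T, p ∈ zeroSet G}
  rcases A.eq_empty_or_nonempty with hA0 | ⟨a, ha⟩
  · exact .inr (by rw [hST, hA0, Set.empty_union])
  by_contra! h
  have exists_form {U : Set (MvPolynomial (Fin 3) ℂ)}
      (hU : {p | ∀ G ∈ U, p ∈ zeroSet G} ⊆ zeroSet F)
      (hne : zeroSet F ≠ {p | ∀ G ∈ U, p ∈ zeroSet G}) :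
      ∃ G ∈ U, ∃ p ∈ zeroSet F, p ∉ zeroSet G := by
    by_contra! hcon
    exact hne (Set.Subset.antisymm (fun p hp G hG ↦ hcon G hG p hp) hU)
  obtain ⟨G, hG, p, hpF, hpG⟩ := exists_form (hST ▸ Set.subset_union_left) h.1
  obtain ⟨H, hH, q, hqF, hqH⟩ := exists_form (hST ▸ Set.subset_union_right) h.2
  obtain ⟨m, hGm⟩ := hS G hG
  obtain ⟨k, hHk⟩ := hT H hH
  have hprime : (Ideal.span {F}).IsPrime :=
    (Ideal.span_singleton_prime hirr.ne_zero).mpr hirr.prime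
  -- `G * H` vanishes on the cone over the curve, and by the Nullstellensatz the prime ideal `(F)`
  -- is the full vanishing ideal of that cone.
  have hmem : G * H ∈ Ideal.span {F} := by
    rw [← IsPrime.vanishingIdeal_zeroLocus (K := ℂ) (Ideal.span {F}), mem_vanishingIdeal_iff]
    intro w hw
    have hwF : eval w F = 0 := by
      simpa [aeval_eq_eval] using hw F (Ideal.mem_span_singleton_self F)
    rw [aeval_eq_eval, map_mul]
    rcases eq_or_ne w 0 with rfl | hw0
    · rw [eval_zero_of_mem hGm (ha G hG), zero_mul]
    · have : Projectivization.mk ℂ w hw0 ∈ A ∪ B :=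
        hST ▸ (eval_rep_eq_zero_iff hF hw0).mpr hwF
      rcases this with h' | h'
      · rw [(eval_rep_eq_zero_iff hGm hw0).mp (h' G hG), zero_mul]
      · rw [(eval_rep_eq_zero_iff hHk hw0).mp (h' H hH), mul_zero]
  have vanish {G : MvPolynomial (Fin 3) ℂ} (hG : G ∈ Ideal.span {F}) {p : CP2}
      (hp : p ∈ zeroSet F) : p ∈ zeroSet G := by
    obtain ⟨K, rfl⟩ := Ideal.mem_span_singleton.mp hG
    have : eval p.rep F = 0 := hp
    simp [zeroSet, this]
  rcases hprime.mem_or_mem hmem with hmem | hmem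
  · exact hpG (vanish hmem hpF)
  · exact hqH (vanish hmem hqF)

/-- A primitive quadratic polynomial over a domain is irreducible if its discriminant is not a
square. -/
theorem irreducible_of_disc_ne_sq {R : Type*} [CommRing R] [IsDomain R] {a b c : R} (ha : a ≠ 0)
    (hprim : ∀ u, u ∣ a → u ∣ b → u ∣ c → IsUnit u) (hdisc : ∀ s, s ^ 2 ≠ b ^ 2 - 4 * a * c) :
    Irreducible (Polynomial.C a * Polynomial.X ^ 2 + Polynomial.C b * Polynomial.X +
      Polynomial.C c) := by
  set f := Polynomial.C a * Polynomial.X ^ 2 + Polynomial.C b * Polynomial.X + Polynomial.C c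
    with hf
  have hdeg : f.natDegree = 2 := Polynomial.natDegree_quadratic ha
  have coeffs (a b c : R) : (Polynomial.C a * Polynomial.X ^ 2 + Polynomial.C b * Polynomial.X +
      Polynomial.C c).coeff 0 = c ∧ (Polynomial.C a * Polynomial.X ^ 2 +
      Polynomial.C b * Polynomial.X + Polynomial.C c).coeff 1 = b ∧
      (Polynomial.C a * Polynomial.X ^ 2 + Polynomial.C b * Polynomial.X +
      Polynomial.C c).coeff 2 = a := by simp
  obtain ⟨h0, h1, h2⟩ := coeffs a b c
  rw [← hf] at h0 h1 h2
  have hunit (u : R) (h : Polynomial.C u ∣ f) : IsUnit (Polynomial.C u) := by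
    rw [Polynomial.C_dvd_iff_dvd_coeff] at h
    exact Polynomial.isUnit_C.mpr (hprim u (h2 ▸ h 2) (h1 ▸ h 1) (h0 ▸ h 0))
  refine ⟨fun h ↦ ?_, fun p q hpq ↦ ?_⟩
  · have := Polynomial.natDegree_eq_zero_of_isUnit h
    omega
  have hf0 : f ≠ 0 := by
    intro h
    simp [h] at hdeg
  have hp0 : p ≠ 0 := left_ne_zero_of_mul (hpq ▸ hf0)
  have hq0 : q ≠ 0 := right_ne_zero_of_mul (hpq ▸ hf0)
  have hsum : p.natDegree + q.natDegree = 2 := by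
    rw [← Polynomial.natDegree_mul hp0 hq0, ← hpq, hdeg]
  obtain hp | hq | ⟨hp, hq⟩ : p.natDegree = 0 ∨ q.natDegree = 0 ∨
      p.natDegree ≤ 1 ∧ q.natDegree ≤ 1 := by omega
  · left
    rw [Polynomial.eq_C_of_natDegree_eq_zero hp] at hpq ⊢
    exact hunit _ (hpq ▸ dvd_mul_right _ _)
  · right
    rw [Polynomial.eq_C_of_natDegree_eq_zero hq] at hpq ⊢
    exact hunit _ (hpq ▸ dvd_mul_left _ _)
  · exfalso
    obtain ⟨k, l, rfl⟩ := Polynomial.exists_eq_X_add_C_of_natDegree_le_one hp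
    obtain ⟨m, n, rfl⟩ := Polynomial.exists_eq_X_add_C_of_natDegree_le_one hq
    have hexp : f = Polynomial.C (k * m) * Polynomial.X ^ 2 +
        Polynomial.C (k * n + l * m) * Polynomial.X + Polynomial.C (l * n) := by
      rw [hpq]
      simp only [map_add, map_mul]
      ring
    obtain ⟨e0, e1, e2⟩ := coeffs (k * m) (k * n + l * m) (l * n)
    rw [← hexp] at e0 e1 e2
    -- The discriminant of `(kX + l)(mX + n)` is `(kn - lm)²`.
    exact hdisc (k * n - l * m) (by rw [← h0, ← h1, ← h2, e0, e1, e2]; ring)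

end PlaneCurve

/-! ### Irreducibility of the quartic -/

namespace EqualVelocity

open PlaneCurve

/-- The discriminant of the quartic as a polynomial of degree two in `u₀`, up to the factor
`4 u₂²`, in the chart `u₂ = 1`, is not a square. -/
theorem sq_ne_affine_disc {v d : ℂ} (hd : d ≠ 0) (hv : v ≠ 0) (s : Polynomial ℂ) :
    s ^ 2 ≠ Polynomial.C (v ^ 2) * (1 + Polynomial.X ^ 2) ^ 2 -
      (Polynomial.C d + Polynomial.C (2 * v) * Polynomial.X + Polynomial.C d * Polynomial.X ^ 2) ^ 2
    := by
  intro h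
  have hdeg : s.natDegree ≤ 2 := by
    have h1 : (s ^ 2).natDegree ≤ 4 := by
      rw [h]
      compute_degree
    rw [Polynomial.natDegree_pow] at h1
    omega
  obtain ⟨α, β, γ, rfl⟩ : ∃ α β γ : ℂ, s = Polynomial.C α + Polynomial.C β * Polynomial.X +
      Polynomial.C γ * Polynomial.X ^ 2 := by
    refine ⟨s.coeff 0, s.coeff 1, s.coeff 2, ?_⟩
    conv_lhs => rw [s.as_sum_range_C_mul_X_pow' (Nat.lt_succ_of_le hdeg)]
    simp [Finset.sum_range_succ]
  have hexp : Polynomial.C (α ^ 2) + Polynomial.C (2 * α * β) * Polynomial.X +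
      Polynomial.C (2 * α * γ + β ^ 2) * Polynomial.X ^ 2 +
      Polynomial.C (2 * β * γ) * Polynomial.X ^ 3 + Polynomial.C (γ ^ 2) * Polynomial.X ^ 4 =
      Polynomial.C (v ^ 2 - d ^ 2) + Polynomial.C (-4 * d * v) * Polynomial.X +
      Polynomial.C (-2 * v ^ 2 - 2 * d ^ 2) * Polynomial.X ^ 2 +
      Polynomial.C (-4 * d * v) * Polynomial.X ^ 3 +
      Polynomial.C (v ^ 2 - d ^ 2) * Polynomial.X ^ 4 := by
    simp only [map_add, map_sub, map_mul, map_pow, map_neg, map_ofNat] at h ⊢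
    linear_combination h
  have coeffs {a₀ a₁ a₂ a₃ a₄ b₀ b₁ b₂ b₃ b₄ : ℂ} (h : Polynomial.C a₀ +
      Polynomial.C a₁ * Polynomial.X + Polynomial.C a₂ * Polynomial.X ^ 2 +
      Polynomial.C a₃ * Polynomial.X ^ 3 + Polynomial.C a₄ * Polynomial.X ^ 4 =
      Polynomial.C b₀ + Polynomial.C b₁ * Polynomial.X + Polynomial.C b₂ * Polynomial.X ^ 2 +
      Polynomial.C b₃ * Polynomial.X ^ 3 + Polynomial.C b₄ * Polynomial.X ^ 4) :
      a₀ = b₀ ∧ a₁ = b₁ ∧ a₂ = b₂ ∧ a₃ = b₃ := by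
    have hc (n : ℕ) := congrArg (fun p ↦ Polynomial.coeff p n) h
    exact ⟨by simpa using hc 0, by simpa [Polynomial.coeff_X, Polynomial.coeff_C] using hc 1,
      by simpa [Polynomial.coeff_X, Polynomial.coeff_C] using hc 2,
      by simpa [Polynomial.coeff_X, Polynomial.coeff_C] using hc 3⟩
  obtain ⟨c0, c1, c2, c3⟩ := coeffs hexp
  have hβ : β ≠ 0 := by
    rintro rfl
    simp [hd, hv] at c1
  -- The coefficients of degrees 1 and 3 of the discriminant agree.
  have hαγ : α = γ := mul_left_cancel₀ hβ (by linear_combination c1 / 2 - c3 / 2)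
  have hβ2 : β ^ 2 = -4 * v ^ 2 := by
    rw [← hαγ] at c2
    linear_combination c2 - 2 * c0
  -- Squaring `c1` gives `4α²β² = 16d²v²`; inserting `α² = v² - d²` and `β² = -4v²` leaves `v⁴ = 0`.
  have : v ^ 4 = 0 := by
    linear_combination (v ^ 2 - d ^ 2) / 4 * hβ2 + β ^ 2 / 4 * c0 -
      (α * β / 8 - d * v / 4) * c1
  exact hv (by simpa using this)

/-- The leading coefficient of the quartic as a polynomial in `u₀`. -/
noncomputable def leadingForm (v d : ℂ) : MvPolynomial (Fin 2) ℂ :=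
  C d * X 1 ^ 2 + C (2 * v) * X 0 * X 1 + C d * X 0 ^ 2

theorem finSuccEquiv_quartic (v d : ℂ) :
    finSuccEquiv ℂ 2 (quartic v d) =
      Polynomial.C (leadingForm v d) * Polynomial.X ^ 2 +
        Polynomial.C (-(C (2 * v) * (X 1 ^ 2 + X 0 ^ 2) * X 1)) * Polynomial.X +
        Polynomial.C (leadingForm v d * X 1 ^ 2) := by
  have h1 : finSuccEquiv ℂ 2 (X 1) = Polynomial.C (X 0) := finSuccEquiv_X_succ (j := 0)
  have h2 : finSuccEquiv ℂ 2 (X 2) = Polynomial.C (X 1) := finSuccEquiv_X_succ (j := 1)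
  have hC (a : ℂ) : finSuccEquiv ℂ 2 (C a) = Polynomial.C (C a) := by
    simp [finSuccEquiv_apply]
  simp only [quartic, formX, leadingForm, map_add, map_sub, map_mul, map_pow, map_neg, h1, h2,
    finSuccEquiv_X_zero, hC]
  ring

/-- Since `X = d(u₁² + u₂²) + 2vu₁u₂`, a common divisor divides `u₁u₂²`, hence `u₂⁴`; but `u₂` does
not divide `X` because `d ≠ 0`. -/
theorem isUnit_of_dvd_coefficients {v d : ℂ} (hd : d ≠ 0) (hv : v ≠ 0)
    {u : MvPolynomial (Fin 2) ℂ} (hA : u ∣ leadingForm v d)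
    (hB : u ∣ -(C (2 * v) * (X 1 ^ 2 + X 0 ^ 2) * X 1)) : IsUnit u := by
  have hv' : (C (2 * v) : MvPolynomial (Fin 2) ℂ) * C (2 * v)⁻¹ = 1 := by
    rw [← C_mul, mul_inv_cancel₀ (by simpa using hv), C_1]
  have hB' : u ∣ (X 1 ^ 2 + X 0 ^ 2) * X 1 := by
    convert hB.mul_left (-C (2 * v)⁻¹) using 1
    linear_combination (-(X 1 ^ 2 + X 0 ^ 2) * X 1) * hv'
  have hyz : u ∣ X 0 * X 1 ^ 2 := by
    convert ((hA.mul_left (X 1)).sub (hB'.mul_left (C d))).mul_left (C (2 * v)⁻¹) using 1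
    rw [leadingForm]
    linear_combination (-X 0 * X 1 ^ 2) * hv'
  have hz : u ∣ X 1 ^ 4 := by
    convert (hB'.mul_left (X 1)).sub (hyz.mul_left (X 0)) using 1
    ring
  have hrel : IsRelPrime (X 1 : MvPolynomial (Fin 2) ℂ) (leadingForm v d) := by
    rw [(X_prime (i := (1 : Fin 2)) (R := ℂ)).irreducible.isRelPrime_iff_not_dvd]
    rintro ⟨q, hq⟩
    exact hd (by simpa [leadingForm] using congrArg (eval ![1, 0]) hq)
  exact hrel.pow_left hz hA

theorem irreducible_quartic {v d : ℂ} (hd : d ≠ 0) (hv : v ≠ 0) : Irreducible (quartic v d) := by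
  rw [← MulEquiv.irreducible_iff (finSuccEquiv ℂ 2), finSuccEquiv_quartic]
  refine irreducible_of_disc_ne_sq ?_ (fun u hA hB _ ↦ isUnit_of_dvd_coefficients hd hv hA hB) ?_
  · intro h
    exact hd (by simpa [leadingForm] using congrArg (eval ![1, 0]) h)
  · intro s hs
    -- Setting `u₂ = 1` turns the factor `4u₂²` into `4`, which halving the root removes.
    have h := congrArg (aeval ![Polynomial.X, (1 : Polynomial ℂ)]) hs
    have h2 : Polynomial.C (1 / 2 : ℂ) ^ 2 * 4 = 1 := by
      rw [← Polynomial.C_pow, ← map_ofNat Polynomial.C 4, ← Polynomial.C_mul, ← Polynomial.C_1]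
      norm_num
    refine sq_ne_affine_disc hd hv
      (Polynomial.C (1 / 2) * aeval ![Polynomial.X, (1 : Polynomial ℂ)] s) ?_
    simp only [leadingForm, map_pow, map_sub, map_mul, map_neg, map_add, map_ofNat, aeval_X, aeval_C,
      Matrix.cons_val_zero, Matrix.cons_val_one, Polynomial.algebraMap_eq] at h
    rw [mul_pow, h]
    simp only [map_mul, map_pow, map_ofNat]
    linear_combination (Polynomial.C v ^ 2 * (1 + Polynomial.X ^ 2) ^ 2 -
      (Polynomial.C d + 2 * Polynomial.C v * Polynomial.X +
        Polynomial.C d * Polynomial.X ^ 2) ^ 2) * h2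

end EqualVelocity

theorem mainTheorem7 (v d : ℂ) (hd : d ≠ 0) (hv : v ≠ 0) :
    -- `V(v,d)` is an irreducible quartic curve, as a polynomial and as a variety
    ((EqualVelocity.quartic v d).IsHomogeneous 4 ∧
      Irreducible (EqualVelocity.quartic v d) ∧
      PlaneCurve.IsIrreducibleVariety (EqualVelocity.V v d)) ∧
    -- the singular points
    (d ≠ 2 * v → d ≠ -(2 * v) →
      PlaneCurve.singularPoints (EqualVelocity.quartic v d) =
        {EqualVelocity.point100, EqualVelocity.point010}) ∧
    (d = 2 * v →
      PlaneCurve.singularPoints (EqualVelocity.quartic v d) =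
        {EqualVelocity.point100, EqualVelocity.point010, EqualVelocity.pointPlus} ∧
      EqualVelocity.pointPlus ≠ EqualVelocity.point100 ∧
      EqualVelocity.pointPlus ≠ EqualVelocity.point010 ∧
      PlaneCurve.IsNode (EqualVelocity.quartic v d) EqualVelocity.pointPlus) ∧
    (d = -(2 * v) →
      PlaneCurve.singularPoints (EqualVelocity.quartic v d) =
        {EqualVelocity.point100, EqualVelocity.point010, EqualVelocity.pointMinus} ∧
      EqualVelocity.pointMinus ≠ EqualVelocity.point100 ∧
      EqualVelocity.pointMinus ≠ EqualVelocity.point010 ∧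
      PlaneCurve.IsNode (EqualVelocity.quartic v d) EqualVelocity.pointMinus) ∧
    -- the types of the singular points `[1,0,0]` and `[0,1,0]`
    (d ^ 2 ≠ v ^ 2 →
      PlaneCurve.IsNode (EqualVelocity.quartic v d) EqualVelocity.point100 ∧
      PlaneCurve.IsNode (EqualVelocity.quartic v d) EqualVelocity.point010) ∧
    (d ^ 2 = v ^ 2 →
      PlaneCurve.IsOrdinaryCusp (EqualVelocity.quartic v d) EqualVelocity.point100 ∧
      PlaneCurve.IsOrdinaryCusp (EqualVelocity.quartic v d) EqualVelocity.point010) := by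
  refine ⟨⟨EqualVelocity.isHomogeneous_quartic v d, EqualVelocity.irreducible_quartic hd hv, ?_⟩,
    EqualVelocity.singularPoints_quartic hd hv, ?_, ?_, ?_, ?_⟩
  · exact PlaneCurve.isIrreducibleVariety_zeroSet (EqualVelocity.isHomogeneous_quartic v d)
      (EqualVelocity.irreducible_quartic hd hv)
      ⟨_, (EqualVelocity.point100_mem_singularPoints v d).1⟩
  · rintro rfl
    exact ⟨EqualVelocity.singularPoints_quartic_two_mul hv,
      EqualVelocity.pointPlus_ne_point100, EqualVelocity.pointPlus_ne_point010,
      EqualVelocity.isNode_quartic_pointPlus hv⟩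
  · rintro rfl
    exact ⟨EqualVelocity.singularPoints_quartic_neg_two_mul hv,
      EqualVelocity.pointMinus_ne_point100, EqualVelocity.pointMinus_ne_point010,
      EqualVelocity.isNode_quartic_pointMinus hv⟩
  · exact fun h ↦ ⟨EqualVelocity.isNode_quartic_point100 hd h,
      EqualVelocity.isNode_quartic_point010 hd h⟩
  · exact fun h ↦ ⟨EqualVelocity.isOrdinaryCusp_quartic_point100 hd h,
      EqualVelocity.isOrdinaryCusp_quartic_point010 hd h⟩
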